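/- Let $(\mathcal Z,d)$ be a nonempty compact metric space (for example a compact subset of $\mathbb R^m$), and let $\mathcal P(\mathcal Z)$ be the set of Borel probability measures on $\mathcal Z$ with the topology of weak convergence. Let $p\ge 1$, $\varepsilon\ge 0$, $\gamma>0$. For $\mu,\nu\in\mathcal P(\mathcal Z)$ let $$W_p(\mu,\nu)=\inf_{\pi}\Big(\int d(z,z')^p\,d\pi(z,z')\Big)^{1/p},$$ the infimum being over all couplings $\pi$ of $\mu$ and $\nu$ (probability measures on $\mathcal Z\times\mathcal Z$ with marginals $\mu$ and $\nu$), and let $\mathrm{KL}(\mu\,\|\,\nu)=\int\log\frac{d\mu}{d\nu}\,d\mu$ if $\mu\ll\nu$ and $\mathrm{KL}(\mu\,\|\,\nu)=\infty$ otherwise. Let $\mathcal D_n\in\mathcal P(\mathcal Z)$ (for example the empirical distribution of $n\ge1$ points of $\mathcal Z$) and $$\mathcal U(\mathcal D_n)=\{\mathcal D'\in\mathcal P(\mathcal Z):\ \exists\,\mathcal D''\in\mathcal P(\mathcal Z)\ \text{with}\ W_p(\mathcal D_n,\mathcal D'')\le\varepsilon\ \text{and}\ \mathrm{KL}(\mathcal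 D''\,\|\,\mathcal D')\le\gamma\}.$$ Then $\mathcal U(\mathcal D_n)$ is compact in $\mathcal P(\mathcal Z)$ with respect to the weak topology. Moreover, let $\Theta$ be a set and $L:\Theta\times\mathcal Z\to\mathbb R$ a function such that for every $\theta\in\Theta$ the function $L(\theta,\cdot)$ is nonnegative and upper semicontinuous, and there are $c>0$, $z_0\in\mathcal Z$ and $k\in(0,p)$ with $L(\theta,z)\le c\,(1+d(z,z_0)^k)$ for all $z\in\mathcal Z$. Then for every $\theta\in\Theta$, $L(\theta,\cdot)$ is integrable with respect to every $\mathcal D'\in\mathcal U(\mathcal D_n)$, and the supremum $$\sup_{\mathcal D'\in\mathcal U(\mathcal D_n)}\mathbb E_{z\sim\mathcal D'}[L(\theta,z)]$$ is finite and is attained by some element of $\mathcal U(\mathcal D_n)$. -/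

import Mathlib

open MeasureTheory
open scoped ENNReal

namespace SRWDRO

section

variable {Z : Type*} [MetricSpace Z] [MeasurableSpace Z]

/-- The set of couplings of `μ` and `ν`: Borel probability measures on `Z × Z` whose
first marginal is `μ` and whose second marginal is `ν`. -/
def couplings (μ ν : ProbabilityMeasure Z) : Set (ProbabilityMeasure (Z × Z)) :=
  {π | (π : Measure (Z × Z)).fst = (μ : Measure Z) ∧ (π : Measure (Z × Z)).snd = (ν : Measure Z)}

/-- The `p`-th Wasserstein distance
`W_p(μ, ν) = inf over couplings π of (E_{(z, z') ∼ π} d(z, z') ^ p) ^ (1 / p)`,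
as an extended nonnegative real number. -/
noncomputable def wasserstein (p : ℝ) (μ ν : ProbabilityMeasure Z) : ℝ≥0∞ :=
  ⨅ π ∈ couplings μ ν, (∫⁻ x, edist x.1 x.2 ^ p ∂(π : Measure (Z × Z))) ^ (1 / p)

/-- The ambiguity set `U(D)`: all `D'` for which there is a `D''` with `W_p(D, D'') ≤ ε` and
`KL(D'' ‖ D') ≤ γ`. The divergence is `∫ log (dD''/dD') dD''` if `D''` is absolutely continuous
with respect to `D'`, and `∞` otherwise. -/
def ambiguitySet (p ε γ : ℝ) (D : ProbabilityMeasure Z) : Set (ProbabilityMeasure Z) :=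
  {D' | ∃ D'' : ProbabilityMeasure Z, wasserstein p D D'' ≤ ENNReal.ofReal ε ∧
    InformationTheory.klDiv (D'' : Measure Z) (D' : Measure Z) ≤ ENNReal.ofReal γ}

/-- The statistically robust loss of a function `f` (the loss of a fixed model): the supremum of
`E_{z ∼ D'} f(z)` over `D'` in the ambiguity set. -/
noncomputable def robustLoss (p ε γ : ℝ) (D : ProbabilityMeasure Z) (f : Z → ℝ) : ℝ :=
  sSup ((fun D' : ProbabilityMeasure Z => ∫ z, f z ∂(D' : Measure Z)) '' ambiguitySet p ε γ D)

end

/-- The assumption on the loss: for every `θ`, the function `L θ` is nonnegative, upper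
semicontinuous, and of growth at most `c * (1 + d(z, z₀) ^ k)` with `0 < k < p`
(`c`, `z₀`, `k` may depend on `θ`). -/
structure LossAssumption {Z Θ : Type*} [MetricSpace Z] (p : ℝ) (L : Θ → Z → ℝ) : Prop where
  nonneg : ∀ θ z, 0 ≤ L θ z
  upperSemicontinuous : ∀ θ, UpperSemicontinuous (L θ)
  growth : ∀ θ, ∃ c : ℝ, 0 < c ∧ ∃ z₀ : Z, ∃ k : ℝ, 0 < k ∧ k < p ∧
    ∀ z, L θ z ≤ c * (1 + dist z z₀ ^ k)

end SRWDRO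

/-!
Since `Z` is a compact metric space, `ProbabilityMeasure Z` is compact and metrizable. The ambiguity
set is the projection to the second factor of the set of pairs `(D'', D')` with
`wasserstein p D D'' ≤ ε` and `klDiv D'' D' ≤ γ`, so its compactness follows once each of these two
conditions is closed.

* The Wasserstein ball is, for the radius `r`, the intersection over `s > r` of the sets of second
  marginals of transport plans from `D` with `p`-cost at most `s`. The cost `edist ^ p` is bounded
  and continuous, so these sets of plans are compact (`isClosed_setOf_wasserstein_le`).
* The divergence has a variational characterisation: `klDiv μ ν ≤ c` if and only if
  `∫ f ∂μ ≤ c + ∫ (exp f - 1) ∂ν` for all bounded continuous `f`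
  (`klDiv_le_ofReal_iff_forall_boundedContinuous`), and each of these inequalities is closed in
  `(μ, ν)` for the weak topology. One direction is the Fenchel–Young inequality for `klFun`. For the
  other, `L¹` density of continuous functions extends the inequality to bounded measurable `f`;
  multiples of indicators of null sets give `μ ≪ ν`, and logarithms of truncated densities together
  with Fatou's lemma give the bound on the divergence.

For the supremum, the integral of a bounded upper semicontinuous function is upper semicontinuous
for the weak topology, by the layer-cake formula, the portmanteau inequality for open sets and
Fatou's lemma; it therefore attains its maximum on the ambiguity set, which is nonempty because it
contains its centre. Integrability and finiteness come from the growth assumption, which bounds the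
loss on a space of finite diameter.
-/

open Filter Topology InformationTheory BoundedContinuousFunction

namespace SRWDRO

/-! ### A variational characterisation of the Kullback–Leibler divergence -/

/-- Fenchel–Young inequality: `y ↦ exp y - 1` is the convex conjugate of `klFun`. -/
lemma mul_le_klFun_add_exp_sub_one {x : ℝ} (hx : 0 ≤ x) (y : ℝ) :
    x * y ≤ klFun x + (Real.exp y - 1) := by
  rw [klFun_apply]
  rcases hx.eq_or_lt with rfl | hx
  · simpa using (Real.exp_pos y).le
  · have h := mul_le_mul_of_nonneg_left (Real.add_one_le_exp (y - Real.log x)) hx.le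
    rw [Real.exp_sub, Real.exp_log hx, mul_div_cancel₀ _ hx.ne'] at h
    linarith

section Variational

variable {X : Type*} [MeasurableSpace X] {μ ν : Measure X} [IsFiniteMeasure μ]

lemma integrable_of_bounded {f : X → ℝ} (hf : Measurable f) {C : ℝ} (hC : ∀ x, |f x| ≤ C) :
    Integrable f μ :=
  .of_bound hf.aestronglyMeasurable C (ae_of_all _ hC)

lemma integrable_exp_sub_one_of_bounded {f : X → ℝ} (hf : Measurable f) {C : ℝ}
    (hC : ∀ x, |f x| ≤ C) : Integrable (fun x ↦ Real.exp (f x) - 1) μ := by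
  refine (integrable_of_bounded (by fun_prop) (C := Real.exp C) fun x ↦ ?_).sub
    (integrable_const 1)
  rw [Real.abs_exp]
  exact Real.exp_le_exp.2 ((le_abs_self _).trans (hC x))

lemma integrable_rnDeriv_mul_of_bounded {f : X → ℝ} (hf : Measurable f) {C : ℝ}
    (hC : ∀ x, |f x| ≤ C) : Integrable (fun x ↦ (μ.rnDeriv ν x).toReal * f x) ν :=
  Measure.integrable_toReal_rnDeriv.mul_bdd hf.aestronglyMeasurable (ae_of_all _ hC)

/-- Testing against large multiples of the indicator of a `ν`-null set forces that set to be
`μ`-null. -/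
lemma absolutelyContinuous_of_forall_integral_le {c : ℝ}
    (h : ∀ f : X → ℝ, Measurable f → (∃ C : ℝ, ∀ x, |f x| ≤ C) →
      ∫ x, f x ∂μ ≤ c + ∫ x, (Real.exp (f x) - 1) ∂ν) : μ ≪ ν := by
  refine Measure.AbsolutelyContinuous.mk fun A hA hνA ↦ ?_
  have key (t : ℝ) : t * μ.real A ≤ c := by
    have := h (A.indicator fun _ ↦ t) (measurable_const.indicator hA)
      ⟨|t|, fun x ↦ by by_cases hx : x ∈ A <;> simp [hx]⟩
    have h0 : ∫ x, (Real.exp (A.indicator (fun _ ↦ t) x) - 1) ∂ν = 0 := by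
      refine integral_eq_zero_of_ae ?_
      filter_upwards [measure_eq_zero_iff_ae_notMem.1 hνA] with x hx
      simp [hx]
    rw [integral_indicator_const t hA, h0, smul_eq_mul] at this
    linarith
  have h0 : μ.real A = 0 := by
    by_contra hne
    have := key ((c + 1) / μ.real A)
    rw [div_mul_cancel₀ _ hne] at this
    linarith
  exact (measureReal_eq_zero_iff).1 h0

variable [IsFiniteMeasure ν]

lemma integral_le_add_integral_exp_sub_one_of_klDiv_le {c : ℝ} (hc : 0 ≤ c)
    (h : klDiv μ ν ≤ ENNReal.ofReal c) {f : X → ℝ} (hf : Measurable f) {C : ℝ}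
    (hC : ∀ x, |f x| ≤ C) :
    ∫ x, f x ∂μ ≤ c + ∫ x, (Real.exp (f x) - 1) ∂ν := by
  have hne : klDiv μ ν ≠ ∞ := ne_top_of_le_ne_top ENNReal.ofReal_ne_top h
  obtain ⟨hac, hint⟩ := klDiv_ne_top_iff.1 hne
  have hkl : (klDiv μ ν).toReal ≤ c := ENNReal.toReal_le_of_le_ofReal hc h
  rw [toReal_klDiv_eq_integral_klFun hac] at hkl
  have hexp := integrable_exp_sub_one_of_bounded (μ := ν) hf hC
  have hkli := (integrable_klFun_rnDeriv_iff hac).2 hint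
  calc ∫ x, f x ∂μ = ∫ x, (μ.rnDeriv ν x).toReal * f x ∂ν := (integral_rnDeriv_smul hac).symm
    _ ≤ ∫ x, (klFun (μ.rnDeriv ν x).toReal + (Real.exp (f x) - 1)) ∂ν :=
        integral_mono (integrable_rnDeriv_mul_of_bounded hf hC) (hkli.add hexp)
          fun x ↦ mul_le_klFun_add_exp_sub_one ENNReal.toReal_nonneg _
    _ = (∫ x, klFun (μ.rnDeriv ν x).toReal ∂ν) + ∫ x, (Real.exp (f x) - 1) ∂ν :=
        integral_add hkli hexp
    _ ≤ _ := by gcongr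

/-- For a test value `log c` with `c` the truncation of `x` to `[δ, δ⁻¹]`, the Fenchel–Young lower
bound of `klFun x` is nonnegative. -/
lemma mul_log_truncation_nonneg {x δ : ℝ} (hδ : 0 < δ) (hδ1 : δ ≤ 1) :
    0 ≤ x * Real.log (max δ (min x δ⁻¹)) + 1 - max δ (min x δ⁻¹) := by
  set c := max δ (min x δ⁻¹) with hc
  have hc0 : 0 < c := hδ.trans_le (le_max_left _ _)
  have hk : 0 ≤ c * Real.log c + 1 - c := klFun_nonneg hc0.le
  suffices c * Real.log c ≤ x * Real.log c by linarith
  have h1 : 1 ≤ δ⁻¹ := (one_le_inv₀ hδ).2 hδ1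
  rcases le_total x 1 with hx | hx
  · have hmin : min x δ⁻¹ = x := min_eq_left (hx.trans h1)
    exact mul_le_mul_of_nonpos_right (by rw [hc, hmin]; exact le_max_right _ _)
      (Real.log_nonpos hc0.le (by rw [hc, hmin]; exact max_le hδ1 hx))
  · have hmax : c = min x δ⁻¹ := max_eq_right (le_min (hδ1.trans hx) (hδ1.trans h1))
    exact mul_le_mul_of_nonneg_right (hmax ▸ min_le_left _ _)
      (Real.log_nonneg (hmax ▸ le_min hx h1))

lemma tendsto_mul_log_truncation {x : ℝ} (hx : 0 ≤ x) :
    Tendsto (fun δ : ℝ ↦ x * Real.log (max δ (min x δ⁻¹)) + 1 - max δ (min x δ⁻¹)) (𝓝[>] 0)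
      (𝓝 (klFun x)) := by
  have hlt : ∀ᶠ δ : ℝ in 𝓝[>] 0, x ≤ δ⁻¹ := tendsto_inv_nhdsGT_zero.eventually_ge_atTop x
  rcases hx.eq_or_lt with rfl | hx
  · have : Tendsto (fun δ : ℝ ↦ 1 - δ) (𝓝[>] 0) (𝓝 (1 - 0)) :=
      (continuous_const.sub continuous_id).continuousAt.mono_left nhdsWithin_le_nhds
    rw [klFun_zero]
    rw [sub_zero] at this
    refine this.congr' ?_
    filter_upwards [hlt, self_mem_nhdsWithin] with δ hδ hδ0
    rw [min_eq_left hδ, max_eq_left (le_of_lt hδ0), zero_mul, zero_add]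
  · refine tendsto_const_nhds.congr' ?_
    filter_upwards [hlt, mem_nhdsWithin_of_mem_nhds (Iio_mem_nhds hx)] with δ hδ hδx
    rw [min_eq_left hδ, max_eq_right (le_of_lt hδx), klFun_apply]

/-- The test functions are the logarithms of truncated densities; Fatou's lemma removes the
truncation. -/
lemma klDiv_le_of_forall_measurable_integral_le {c : ℝ}
    (h : ∀ f : X → ℝ, Measurable f → (∃ C : ℝ, ∀ x, |f x| ≤ C) →
      ∫ x, f x ∂μ ≤ c + ∫ x, (Real.exp (f x) - 1) ∂ν) : klDiv μ ν ≤ ENNReal.ofReal c := by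
  have hac := absolutelyContinuous_of_forall_integral_le h
  obtain ⟨δ, -, hδ, hδlim⟩ := exists_seq_strictAnti_tendsto' (zero_lt_one (α := ℝ))
  have hδlim' : Tendsto δ atTop (𝓝[>] 0) :=
    tendsto_nhdsWithin_iff.2 ⟨hδlim, .of_forall fun n ↦ (hδ n).1⟩
  set r : X → ℝ := fun x ↦ (μ.rnDeriv ν x).toReal with hr
  have hrm : Measurable r := by fun_prop
  set t : ℕ → X → ℝ := fun n x ↦ max (δ n) (min (r x) (δ n)⁻¹) with ht
  have htm (n) : Measurable (t n) := by fun_prop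
  have htpos (n x) : 0 < t n x := (hδ n).1.trans_le (le_max_left _ _)
  have hlog (n x) : |Real.log (t n x)| ≤ -Real.log (δ n) := by
    have h1 : 1 ≤ (δ n)⁻¹ := (one_le_inv₀ (hδ n).1).2 (hδ n).2.le
    rw [abs_le, neg_neg, ← Real.log_inv]
    exact ⟨Real.log_le_log (hδ n).1 (le_max_left _ _),
      Real.log_le_log (htpos n x) (max_le ((hδ n).2.le.trans h1) (min_le_right _ _))⟩
  have hbound (n) : ∫⁻ x, ENNReal.ofReal (r x * Real.log (t n x) + 1 - t n x) ∂ν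
      ≤ ENNReal.ofReal c := by
    have hlogm : Measurable fun x ↦ Real.log (t n x) := (htm n).log
    have hi1 := integrable_rnDeriv_mul_of_bounded (μ := μ) (ν := ν) hlogm (hlog n)
    have hi2 := integrable_exp_sub_one_of_bounded (μ := ν) hlogm (hlog n)
    have heq : (fun x ↦ r x * Real.log (t n x) + 1 - t n x)
        = fun x ↦ r x * Real.log (t n x) - (Real.exp (Real.log (t n x)) - 1) := by
      ext x
      rw [Real.exp_log (htpos n x)]
      ring
    rw [← ofReal_integral_eq_lintegral_ofReal (heq ▸ hi1.sub hi2)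
      (ae_of_all _ fun x ↦ mul_log_truncation_nonneg (hδ n).1 (hδ n).2.le), heq,
      integral_sub hi1 hi2, integral_toReal_rnDeriv_mul hac]
    exact ENNReal.ofReal_le_ofReal (by linarith [h _ hlogm ⟨_, hlog n⟩])
  rw [klDiv_eq_lintegral_klFun_of_ac hac]
  calc ∫⁻ x, ENNReal.ofReal (klFun (r x)) ∂ν
      = ∫⁻ x, liminf (fun n ↦ ENNReal.ofReal (r x * Real.log (t n x) + 1 - t n x)) atTop ∂ν := by
        refine lintegral_congr fun x ↦ Eq.symm (Tendsto.liminf_eq ?_)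
        exact ENNReal.tendsto_ofReal
          ((tendsto_mul_log_truncation ENNReal.toReal_nonneg).comp hδlim')
    _ ≤ liminf (fun n ↦ ∫⁻ x, ENNReal.ofReal (r x * Real.log (t n x) + 1 - t n x) ∂ν) atTop :=
        lintegral_liminf_le fun n ↦ by fun_prop
    _ ≤ ENNReal.ofReal c := by
        refine liminf_le_of_le (by isBoundedDefault) fun b hb ↦ ?_
        obtain ⟨n, hn⟩ := hb.exists
        exact hn.trans (hbound n)

end Variational

section Continuous

variable {X : Type*} [MeasurableSpace X] [TopologicalSpace X]
  [TopologicalSpace.PseudoMetrizableSpace X] [BorelSpace X] {μ ν : Measure X}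
  [IsFiniteMeasure μ] [IsFiniteMeasure ν]

lemma abs_exp_sub_exp_le {a b C : ℝ} (ha : a ≤ C) (hb : b ≤ C) :
    |Real.exp a - Real.exp b| ≤ Real.exp C * |a - b| := by
  have aux {a b : ℝ} (ha : a ≤ C) : Real.exp a - Real.exp b ≤ Real.exp C * |a - b| := by
    have h1 : 1 - Real.exp (b - a) ≤ |a - b| := by
      linarith [Real.add_one_le_exp (b - a), le_abs_self (a - b)]
    calc Real.exp a - Real.exp b = Real.exp a * (1 - Real.exp (b - a)) := by
          rw [mul_sub, mul_one, ← Real.exp_add, add_sub_cancel]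
      _ ≤ Real.exp a * |a - b| := by gcongr
      _ ≤ _ := by gcongr
  refine abs_le.2 ⟨?_, aux ha⟩
  have := aux (a := b) (b := a) hb
  rw [abs_sub_comm] at this
  linarith

/-- Bounded continuous functions are `L¹(μ + ν)`-dense among the bounded measurable ones, and
clamping an approximant makes the exponentials converge as well. -/
lemma integral_le_of_forall_boundedContinuous {c : ℝ}
    (h : ∀ f : X →ᵇ ℝ, ∫ x, f x ∂μ ≤ c + ∫ x, (Real.exp (f x) - 1) ∂ν)
    {f : X → ℝ} (hf : Measurable f) {C : ℝ} (hC : ∀ x, |f x| ≤ C) :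
    ∫ x, f x ∂μ ≤ c + ∫ x, (Real.exp (f x) - 1) ∂ν := by
  refine le_of_forall_pos_le_add fun η hη ↦ ?_
  -- `exp` is `exp C`-Lipschitz on `[-C, C]`, so an `L¹`-error `e` costs at most `(1 + exp C) * e`
  set K := 1 + Real.exp C with hK
  have hKpos : 0 < K := by positivity
  obtain ⟨g₀, hg₀, -⟩ := (integrable_of_bounded (μ := μ + ν) hf
    hC).exists_boundedContinuous_integral_sub_le (div_pos hη hKpos)
  -- `g` is `g₀` clamped to `[-C, C]`
  set gf : X → ℝ := fun x ↦ max (-C) (min (g₀ x) C) with hgf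
  have hgc : Continuous gf := by fun_prop
  have hgC (x) : |gf x| ≤ C := by
    have hC0 : 0 ≤ C := (abs_nonneg _).trans (hC x)
    exact abs_le.2 ⟨le_max_left _ _, max_le (by linarith) (min_le_right _ _)⟩
  have hgm : Measurable gf := hgc.measurable
  have hclamp (x) : |f x - gf x| ≤ |f x - g₀ x| := by
    have := abs_le.1 (hC x)
    have h1 : f x = max (-C) (min (f x) C) := by
      rw [min_eq_left this.2, max_eq_right this.1]
    calc |f x - gf x| = |max (-C) (min (f x) C) - gf x| := by rw [← h1]
      _ ≤ |min (f x) C - min (g₀ x) C| := by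
        simpa [hgf] using abs_max_sub_max_le_max (-C) (min (f x) C) (-C) (min (g₀ x) C)
      _ ≤ |f x - g₀ x| := by
        simpa using abs_min_sub_min_le_max (f x) C (g₀ x) C
  have hg := h (BoundedContinuousFunction.ofNormedAddCommGroup gf hgc C hgC)
  simp only [BoundedContinuousFunction.coe_ofNormedAddCommGroup] at hg
  have hd (ρ : Measure X) [IsFiniteMeasure ρ] : Integrable (fun x ↦ |f x - gf x|) ρ :=
    ((integrable_of_bounded hf hC).sub (integrable_of_bounded hgm hgC)).abs
  have hd₀ : Integrable (fun x ↦ |f x - g₀ x|) (μ + ν) :=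
    ((integrable_of_bounded hf hC).sub (g₀.integrable _)).abs
  have hsum : ∫ x, |f x - gf x| ∂μ + ∫ x, |f x - gf x| ∂ν ≤ η / K := by
    rw [← integral_add_measure (hd μ) (hd ν)]
    exact (integral_mono (hd _) hd₀ hclamp).trans hg₀
  have h1 : ∫ x, f x ∂μ - ∫ x, gf x ∂μ ≤ ∫ x, |f x - gf x| ∂μ := by
    rw [← integral_sub (integrable_of_bounded hf hC) (integrable_of_bounded hgm hgC)]
    exact (le_abs_self _).trans abs_integral_le_integral_abs
  have h2 : ∫ x, (Real.exp (gf x) - 1) ∂ν - ∫ x, (Real.exp (f x) - 1) ∂ν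
      ≤ Real.exp C * ∫ x, |f x - gf x| ∂ν := by
    have e1 := integrable_exp_sub_one_of_bounded (μ := ν) hgm hgC
    have e2 := integrable_exp_sub_one_of_bounded (μ := ν) hf hC
    rw [← integral_sub e1 e2, ← integral_const_mul]
    refine integral_mono (e1.sub e2) ((hd ν).const_mul _) fun x ↦ ?_
    have := abs_exp_sub_exp_le ((le_abs_self _).trans (hgC x)) ((le_abs_self _).trans (hC x))
    rw [abs_sub_comm (gf x)] at this
    change (Real.exp (gf x) - 1) - (Real.exp (f x) - 1) ≤ _
    linarith [le_abs_self (Real.exp (gf x) - Real.exp (f x))]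
  have p1 : 0 ≤ ∫ x, |f x - gf x| ∂μ := integral_nonneg fun _ ↦ abs_nonneg _
  have p2 : 0 ≤ ∫ x, |f x - gf x| ∂ν := integral_nonneg fun _ ↦ abs_nonneg _
  have h3 : K * (∫ x, |f x - gf x| ∂μ + ∫ x, |f x - gf x| ∂ν) ≤ η := by
    calc _ ≤ K * (η / K) := by gcongr
      _ = η := mul_div_cancel₀ _ hKpos.ne'
  have h4 := mul_nonneg (Real.exp_pos C).le p1
  rw [hK] at h3
  linarith

/-- Variational characterisation of the sublevel sets of the Kullback–Leibler divergence by bounded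
continuous test functions. -/
theorem klDiv_le_ofReal_iff_forall_boundedContinuous {c : ℝ} (hc : 0 ≤ c) :
    klDiv μ ν ≤ ENNReal.ofReal c ↔
      ∀ f : X →ᵇ ℝ, ∫ x, f x ∂μ ≤ c + ∫ x, (Real.exp (f x) - 1) ∂ν :=
  ⟨fun h f ↦ integral_le_add_integral_exp_sub_one_of_klDiv_le hc h f.continuous.measurable
      f.norm_coe_le_norm,
    fun h ↦ klDiv_le_of_forall_measurable_integral_le fun _ hf ⟨_, hC⟩ ↦
      integral_le_of_forall_boundedContinuous h hf hC⟩

/-- Joint lower semicontinuity of the Kullback–Leibler divergence for the weak topology, in terms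
of sublevel sets. -/
theorem isClosed_setOf_klDiv_le {c : ℝ} (hc : 0 ≤ c) :
    IsClosed {q : ProbabilityMeasure X × ProbabilityMeasure X |
      klDiv (q.1 : Measure X) (q.2 : Measure X) ≤ ENNReal.ofReal c} := by
  simp only [klDiv_le_ofReal_iff_forall_boundedContinuous hc, Set.ofPred_forall]
  refine isClosed_iInter fun f ↦ isClosed_le ?_ (continuous_const.add ?_)
  · exact (ProbabilityMeasure.continuous_integral_boundedContinuousFunction f).comp continuous_fst
  · let g : X →ᵇ ℝ := .ofNormedAddCommGroup (fun x ↦ Real.exp (f x) - 1) (by fun_prop)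
      (Real.exp ‖f‖ + 1) fun x ↦ by
        have := Real.exp_le_exp.2 ((le_abs_self _).trans (f.norm_coe_le_norm x))
        have := Real.exp_pos (f x)
        rw [Real.norm_eq_abs, abs_le]
        constructor <;> linarith
    exact (ProbabilityMeasure.continuous_integral_boundedContinuousFunction g).comp continuous_snd

end Continuous

/-! ### Wasserstein balls -/

section Wasserstein

variable {Z : Type*} [MetricSpace Z] [MeasurableSpace Z] [BorelSpace Z]

lemma wasserstein_self [SecondCountableTopology Z] {p : ℝ} (hp : 0 < p) (μ : ProbabilityMeasure Z) :
    wasserstein p μ μ = 0 := by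
  have hdiag : Measurable fun z : Z ↦ (z, z) := by fun_prop
  refine le_antisymm (iInf₂_le_of_le (μ.map hdiag.aemeasurable) ⟨?_, ?_⟩ ?_) zero_le
  · rw [ProbabilityMeasure.toMeasure_map, Measure.fst_map_prodMk (X := fun z ↦ z) measurable_id']
    exact Measure.map_id
  · rw [ProbabilityMeasure.toMeasure_map, Measure.snd_map_prodMk (Y := fun z ↦ z) measurable_id']
    exact Measure.map_id
  · rw [ProbabilityMeasure.toMeasure_map, lintegral_map (by fun_prop) hdiag]
    simp [hp]

variable [CompactSpace Z]

/-- Weak continuity of the transport cost; it relies on the cost being bounded, as `Z` is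
compact. -/
lemma continuous_lintegral_edist_rpow {p : ℝ} (hp : 0 ≤ p) :
    Continuous fun π : ProbabilityMeasure (Z × Z) ↦
      ∫⁻ x, edist x.1 x.2 ^ p ∂(π : Measure (Z × Z)) := by
  let f : C(Z × Z, NNReal) := ⟨fun x ↦ nndist x.1 x.2 ^ p,
    (NNReal.continuous_rpow_const hp).comp continuous_nndist⟩
  convert ProbabilityMeasure.continuous_lintegral_continuousMap f using 3 with π
  ext x
  simp only [f, ContinuousMap.coe_mk, edist_nndist, ENNReal.coe_rpow_of_nonneg _ hp]

/-- The ball is an intersection of projections of compact sets of transport plans, one for each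
radius exceeding `r`; existence of optimal plans is not needed. -/
theorem isClosed_setOf_wasserstein_le {p : ℝ} (hp : 0 < p) (μ : ProbabilityMeasure Z) (r : ℝ≥0∞) :
    IsClosed {ν : ProbabilityMeasure Z | wasserstein p μ ν ≤ r} := by
  have heq : {ν : ProbabilityMeasure Z | wasserstein p μ ν ≤ r} =
      ⋂ s ∈ Set.Ioi r, (fun π : ProbabilityMeasure (Z × Z) ↦
        π.map measurable_snd.aemeasurable) ''
        {π | π.map measurable_fst.aemeasurable = μ ∧
          (∫⁻ x, edist x.1 x.2 ^ p ∂(π : Measure (Z × Z))) ^ (1 / p) ≤ s} := by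
    ext ν
    simp only [Set.mem_iInter, Set.mem_Ioi, Set.mem_image, Set.mem_ofPred_eq]
    constructor
    · intro h s hs
      obtain ⟨π, hπ⟩ := iInf_lt_iff.1 (h.trans_lt hs)
      obtain ⟨hc, hlt⟩ := iInf_lt_iff.1 hπ
      exact ⟨π, ⟨Subtype.ext hc.1, hlt.le⟩, Subtype.ext hc.2⟩
    · intro h
      refine le_of_forall_gt_imp_ge_of_dense fun s hs ↦ ?_
      obtain ⟨π, ⟨hfst, hle⟩, hsnd⟩ := h s hs
      exact iInf₂_le_of_le π ⟨congrArg Subtype.val hfst, congrArg Subtype.val hsnd⟩ hle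
  rw [heq]
  refine isClosed_biInter fun s _ ↦ (IsCompact.image (IsClosed.isCompact ?_) ?_).isClosed
  · exact (isClosed_eq (ProbabilityMeasure.continuous_map continuous_fst)
      continuous_const).inter (isClosed_le ((ENNReal.continuous_rpow_const).comp
        (continuous_lintegral_edist_rpow hp.le)) continuous_const)
  · exact ProbabilityMeasure.continuous_map continuous_snd

end Wasserstein

/-! ### Semicontinuous integrands and attainment of the supremum -/

section Semicontinuous

variable {X : Type*} [MeasurableSpace X] [TopologicalSpace X]
  [TopologicalSpace.PseudoMetrizableSpace X] [BorelSpace X]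

/-- The layer-cake formula reduces the claim to the portmanteau inequality for the open
superlevel sets. -/
theorem lowerSemicontinuous_lintegral_ofReal [TopologicalSpace.SeparableSpace X] {f : X → ℝ}
    (hf : LowerSemicontinuous f) (hf0 : 0 ≤ f) :
    LowerSemicontinuous fun μ : ProbabilityMeasure X ↦
      ∫⁻ x, ENNReal.ofReal (f x) ∂(μ : Measure X) := by
  rw [lowerSemicontinuous_iff_le_liminf]
  intro μ
  simp_rw [lintegral_eq_lintegral_meas_lt _ (Eventually.of_forall hf0) hf.measurable.aemeasurable]
  calc ∫⁻ t in Set.Ioi (0 : ℝ), (μ : Measure X) {a | t < f a}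
      ≤ ∫⁻ t in Set.Ioi (0 : ℝ),
          liminf (fun ν : ProbabilityMeasure X ↦ (ν : Measure X) {a | t < f a}) (𝓝 μ) :=
        lintegral_mono fun t ↦ ProbabilityMeasure.le_liminf_measure_open_of_tendsto
          (μs := fun ν : ProbabilityMeasure X ↦ ν) tendsto_id
          (lowerSemicontinuous_iff_isOpen_preimage.1 hf t)
    _ ≤ _ := lintegral_liminf_le fun ν ↦ Antitone.measurable fun s t hst ↦
        measure_mono fun _ hω ↦ lt_of_le_of_lt hst hω

/-- The integral of a bounded upper semicontinuous function attains its maximum on compact sets of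
probability measures. -/
theorem exists_isMaxOn_integral_of_upperSemicontinuous [TopologicalSpace.SeparableSpace X]
    {f : X → ℝ} (hf : UpperSemicontinuous f) {C : ℝ} (hC : ∀ x, |f x| ≤ C)
    {S : Set (ProbabilityMeasure X)} (hS : IsCompact S) (hne : S.Nonempty) :
    ∃ μ ∈ S, IsMaxOn (fun μ : ProbabilityMeasure X ↦ ∫ x, f x ∂(μ : Measure X)) S μ := by
  have hg0 : 0 ≤ fun x ↦ C - f x := fun x ↦ sub_nonneg.2 ((le_abs_self _).trans (hC x))
  have hg : LowerSemicontinuous fun x ↦ C - f x := fun x y hy ↦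
    (hf x (C - y) (by linarith)).mono fun z hz ↦ by linarith
  obtain ⟨μ, hμ, hmin⟩ :=
    ((lowerSemicontinuous_lintegral_ofReal hg hg0).lowerSemicontinuousOn S).exists_isMinOn hne hS
  refine ⟨μ, hμ, fun ν hν ↦ ?_⟩
  have hfi (ρ : ProbabilityMeasure X) : Integrable f (ρ : Measure X) :=
    integrable_of_bounded hf.measurable hC
  have hle := hmin hν
  have hgi (ρ : ProbabilityMeasure X) : Integrable (fun x ↦ C - f x) (ρ : Measure X) :=
    (integrable_const C).sub (hfi ρ)
  have hint (ρ : ProbabilityMeasure X) :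
      ∫ x, (C - f x) ∂(ρ : Measure X) = C - ∫ x, f x ∂(ρ : Measure X) := by
    rw [integral_sub (integrable_const C) (hfi ρ)]
    simp
  simp only [Set.mem_ofPred_eq] at hle ⊢
  rw [← ofReal_integral_eq_lintegral_ofReal (hgi μ) (ae_of_all _ hg0),
    ← ofReal_integral_eq_lintegral_ofReal (hgi ν) (ae_of_all _ hg0),
    ENNReal.ofReal_le_ofReal_iff (integral_nonneg hg0), hint, hint] at hle
  linarith

end Semicontinuous

/-! ### The ambiguity set -/

section Ambiguity

variable {Z : Type*} [MetricSpace Z] [CompactSpace Z] [MeasurableSpace Z] [BorelSpace Z]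

/-- The ambiguity set is the projection of a closed subset of the compact space of pairs
`(D'', D')`. -/
theorem isCompact_ambiguitySet {p γ : ℝ} (hp : 0 < p) (ε : ℝ) (hγ : 0 ≤ γ)
    (D : ProbabilityMeasure Z) : IsCompact (ambiguitySet p ε γ D) := by
  have heq : ambiguitySet p ε γ D = Prod.snd ''
      ((Prod.fst ⁻¹' {D'' | wasserstein p D D'' ≤ ENNReal.ofReal ε}) ∩
        {q : ProbabilityMeasure Z × ProbabilityMeasure Z |
          klDiv (q.1 : Measure Z) (q.2 : Measure Z) ≤ ENNReal.ofReal γ}) := by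
    ext D'
    constructor
    · rintro ⟨D'', hW, hK⟩
      exact ⟨(D'', D'), ⟨hW, hK⟩, rfl⟩
    · rintro ⟨⟨D'', D'⟩, ⟨hW, hK⟩, rfl⟩
      exact ⟨D'', hW, hK⟩
  rw [heq]
  exact ((((isClosed_setOf_wasserstein_le hp D _).preimage continuous_fst).inter
    (isClosed_setOf_klDiv_le hγ)).isCompact).image continuous_snd

lemma mem_ambiguitySet_self {p : ℝ} (hp : 0 < p) (ε γ : ℝ) (D : ProbabilityMeasure Z) :
    D ∈ ambiguitySet p ε γ D :=
  ⟨D, by simp [wasserstein_self hp], by simp⟩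

omit [MeasurableSpace Z] [BorelSpace Z] in
lemma LossAssumption.exists_abs_le {Θ : Type*} {p : ℝ} {L : Θ → Z → ℝ} (hL : LossAssumption p L)
    (θ : Θ) : ∃ C, ∀ z, |L θ z| ≤ C := by
  obtain ⟨c, hc, z₀, k, hk, -, hgrowth⟩ := hL.growth θ
  refine ⟨c * (1 + Metric.diam (Set.univ : Set Z) ^ k), fun z ↦ ?_⟩
  rw [abs_of_nonneg (hL.nonneg θ z)]
  refine (hgrowth z).trans ?_
  gcongr
  exact Metric.dist_le_diam_of_mem isCompact_univ.isBounded (Set.mem_univ _) (Set.mem_univ _)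

end Ambiguity

end SRWDRO

theorem mainTheorem3 {Z Θ : Type*} [MetricSpace Z] [CompactSpace Z] [MeasurableSpace Z]
    [BorelSpace Z] (p ε γ : ℝ) (hp : 1 ≤ p) (hε : 0 ≤ ε) (hγ : 0 < γ)
    (D : ProbabilityMeasure Z) :
    IsCompact (SRWDRO.ambiguitySet p ε γ D) ∧
    ∀ L : Θ → Z → ℝ, SRWDRO.LossAssumption p L → ∀ θ : Θ,
      (∀ D' ∈ SRWDRO.ambiguitySet p ε γ D, Integrable (L θ) (D' : Measure Z)) ∧
      BddAbove ((fun D' : ProbabilityMeasure Z => ∫ z, L θ z ∂(D' : Measure Z)) ''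
        SRWDRO.ambiguitySet p ε γ D) ∧
      ∃ Dstar ∈ SRWDRO.ambiguitySet p ε γ D,
        ∫ z, L θ z ∂(Dstar : Measure Z) = SRWDRO.robustLoss p ε γ D (L θ) := by
  have hp0 : 0 < p := by linarith
  have hcompact := SRWDRO.isCompact_ambiguitySet hp0 ε hγ.le D
  refine ⟨hcompact, fun L hL θ ↦ ?_⟩
  obtain ⟨C, hC⟩ := hL.exists_abs_le θ
  have husc := hL.upperSemicontinuous θ
  obtain ⟨Dstar, hmem, hmax⟩ := SRWDRO.exists_isMaxOn_integral_of_upperSemicontinuous husc hC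
    hcompact ⟨D, SRWDRO.mem_ambiguitySet_self hp0 ε γ D⟩
  have hgreatest : IsGreatest ((fun D' : ProbabilityMeasure Z => ∫ z, L θ z ∂(D' : Measure Z)) ''
      SRWDRO.ambiguitySet p ε γ D) (∫ z, L θ z ∂(Dstar : Measure Z)) :=
    ⟨Set.mem_image_of_mem _ hmem, by rintro _ ⟨D', hD', rfl⟩; exact hmax hD'⟩
  exact ⟨fun D' _ ↦ SRWDRO.integrable_of_bounded husc.measurable hC, hgreatest.bddAbove,
    Dstar, hmem, hgreatest.csSup_eq.symm⟩
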